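/- Let $D\subset\mathbb{R}^n$ be a nonempty bounded convex polyhedron (the convex hull of finitely many points), and let $G:D\to\mathbb{R}$ be continuous and strictly convex, in the sense that $G$ is convex and is not constant on any segment $[x,y]\subseteq D$ with $x\neq y$. Let $x^*$ be the (unique) minimizer of $G$ in $D$, $g^*=\min_D G$, $g_{\max}=\max_D G$, and $U_g=\{x\in D\mid G(x)<g\}$. For $x,y\in D$ write $x\succsim y$ if there is a continuous path $\varphi:[0,1]\to D$ with $\varphi(0)=x$, $\varphi(1)=y$ along which $G$ does not increase, and $x\sim y$ if $x\succsim y$ and $y\succsim x$. Let $\mathcal{T}=D/\!\sim$ carry the quotient topology and the partial order $\pi(x)\succsim\pi(y)\Leftrightarrow x\succsim y$, where $\pi:D\to\mathcal{T}$ is the canonical projection; let $[x]\subseteq D$ be the class of $x$. Let $D_0$ be the set of vertices of $D$ and $\widetilde{D_1}$ the graph of the vertices and edges of $D$, where each vertex $v$ is labeled by $G(v)$ and each edge $[v,w]$ by $\min_{[v,w]}G$. Let $\widetilde{D_1}\setminus U_g$ be the graph that consists of the vertices and edges of $\widetilde{D_1}$ with labels $\geq g$. Let $\mathcal{Y}$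 be the set of pairs $(g,M)$ such that $g^*\leq g\leq g_{\max}$ and $M$ is the set of vertices of a connected component of $\widetilde{D_1}\setminus U_g$. Give $\mathcal{Y}$ the partial order $$(g,M)\succsim(g',M')\iff g\geq g'\text{ and }M\subseteq M',$$ and the topology in which a fundamental system of neighbourhoods of $(g,M)$ is formed by the sets $$V_\rho=\{(g',M')\in\mathcal{Y}\mid |g-g'|<\rho,\ M'\subseteq M\}\qquad(\rho>0).$$ For $g\ge g^*$ and $y\in D\setminus U_g$ let $\theta_g(y)$ be the unique point $z\in[x^*,y]$ with $G(z)=g$. Then for every $x\in D$ there is exactly one path-connected component $W(x)$ of $D\setminus U_{G(x)}$ with $\theta_{G(x)}(W(x))=[x]$. Put $$\omega(x)=(G(x),\,W(x)\cap D_0).$$ Then $\omega(x)\in\mathcal{Y}$ for every $x\in D$, and there is a homeomorphism $\Phi:\mathcal{T}\to\mathcal{Y}$ such that $a\succsim b\Leftrightarrow\Phi(a)\succsim\Phi(b)$ for all $a,b\in\mathcal{T}$, and $\Phi\circ\pi=\omega$. -/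

import Mathlib

open Set Topology

/-- A (closed) bounded convex polyhedron: the convex hull of finitely many points. -/
def IsBoundedPolyhedron {n : ℕ} (D : Set (EuclideanSpace ℝ (Fin n))) : Prop :=
  ∃ s : Finset (EuclideanSpace ℝ (Fin n)), D = convexHull ℝ (s : Set (EuclideanSpace ℝ (Fin n)))

/-- The convexity notion used for `G`: `G` is convex on `D` and is not constant on any segment
`[x, y] ⊆ D` with `x ≠ y`. Every function with `StrictConvexOn ℝ D G` has this property. -/
def IsStrictlyConvexIn {n : ℕ} (D : Set (EuclideanSpace ℝ (Fin n)))
    (G : EuclideanSpace ℝ (Fin n) → ℝ) : Prop :=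
  ConvexOn ℝ D G ∧ ∀ x ∈ D, ∀ y ∈ D, x ≠ y → ¬ ∃ c : ℝ, ∀ z ∈ segment ℝ x y, G z = c

section Tree

/-- `x ≿ y`: some continuous path in `D` leads from `x` to `y` without increasing `G`. -/
def Precedes {n : ℕ} (D : Set (EuclideanSpace ℝ (Fin n))) (G : EuclideanSpace ℝ (Fin n) → ℝ)
    (x y : D) : Prop :=
  ∃ φ : Path x y, Antitone fun t : unitInterval => G (φ t)

theorem Precedes.refl {n : ℕ} {D : Set (EuclideanSpace ℝ (Fin n))}
    {G : EuclideanSpace ℝ (Fin n) → ℝ} (x : D) : Precedes D G x x :=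
  ⟨Path.refl x, fun _ _ _ => le_rfl⟩

theorem Precedes.trans {n : ℕ} {D : Set (EuclideanSpace ℝ (Fin n))}
    {G : EuclideanSpace ℝ (Fin n) → ℝ} {x y z : D} (hxy : Precedes D G x y)
    (hyz : Precedes D G y z) : Precedes D G x z := by
  obtain ⟨φ, hφ⟩ := hxy
  obtain ⟨ψ, hψ⟩ := hyz
  have hφ1 : ∀ t, G y ≤ G (φ t) := fun t => by simpa using hφ (unitInterval.le_one' (t := t))
  have hψ0 : ∀ t, G (ψ t) ≤ G y := fun t => by simpa using hψ (unitInterval.nonneg' (t := t))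
  refine ⟨φ.trans ψ, fun s t hst => ?_⟩
  have hst' : (s : ℝ) ≤ t := hst
  simp only [Path.trans_apply]
  split_ifs with h1 h2 h2
  · exact hφ (Subtype.mk_le_mk.mpr (by linarith))
  · exact absurd (hst'.trans h1) h2
  · exact (hψ0 _).trans (hφ1 _)
  · exact hψ (Subtype.mk_le_mk.mpr (by linarith))

/-- `x ∼ y` if `x ≿ y` and `y ≿ x`. -/
def precedesSetoid {n : ℕ} (D : Set (EuclideanSpace ℝ (Fin n)))
    (G : EuclideanSpace ℝ (Fin n) → ℝ) : Setoid D where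
  r x y := Precedes D G x y ∧ Precedes D G y x
  iseqv := ⟨fun x => ⟨.refl x, .refl x⟩, fun h => ⟨h.2, h.1⟩,
    fun h k => ⟨h.1.trans k.1, k.2.trans h.2⟩⟩

/-- The tree of `G` in `D`: the quotient space `D / ∼`. -/
def ThermoTree {n : ℕ} (D : Set (EuclideanSpace ℝ (Fin n)))
    (G : EuclideanSpace ℝ (Fin n) → ℝ) : Type :=
  Quotient (precedesSetoid D G)

/-- The canonical projection `π : D → D / ∼`. -/
def treeProj {n : ℕ} (D : Set (EuclideanSpace ℝ (Fin n)))
    (G : EuclideanSpace ℝ (Fin n) → ℝ) (x : D) : ThermoTree D G :=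
  Quotient.mk (precedesSetoid D G) x

/-- The quotient topology, `D` having the subspace topology. -/
instance ThermoTree.topology {n : ℕ} (D : Set (EuclideanSpace ℝ (Fin n)))
    (G : EuclideanSpace ℝ (Fin n) → ℝ) : TopologicalSpace (ThermoTree D G) :=
  TopologicalSpace.coinduced (treeProj D G) inferInstance

/-- `a ≤ b` on the tree means `b ≿ a`: for `x, y ∈ D`, `π y ≤ π x` iff `x ≿ y`. -/
instance ThermoTree.order {n : ℕ} (D : Set (EuclideanSpace ℝ (Fin n)))
    (G : EuclideanSpace ℝ (Fin n) → ℝ) : PartialOrder (ThermoTree D G) where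
  le := Quotient.lift₂ (fun y x => Precedes D G x y) fun _ _ _ _ h k =>
    propext ⟨fun m => k.2.trans (m.trans h.1), fun m => k.1.trans (m.trans h.2)⟩
  le_refl a := Quotient.inductionOn a fun x => Precedes.refl x
  le_trans a b c := Quotient.inductionOn₃ a b c fun _ _ _ h k => Precedes.trans k h
  le_antisymm a b := Quotient.inductionOn₂ a b fun _ _ h k => Quotient.sound ⟨k, h⟩

theorem treeProj_le_treeProj {n : ℕ} {D : Set (EuclideanSpace ℝ (Fin n))}
    {G : EuclideanSpace ℝ (Fin n) → ℝ} {x y : D} :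
    treeProj D G y ≤ treeProj D G x ↔ Precedes D G x y :=
  Iff.rfl

end Tree

section Coordinates

/-- The graph of the 1-skeleton of `D`: its vertices are the vertices (extreme points) of `D`,
and two distinct vertices are adjacent if the segment between them is a face of `D`. -/
def skeletonGraph {n : ℕ} (D : Set (EuclideanSpace ℝ (Fin n))) :
    SimpleGraph (D.extremePoints ℝ) where
  Adj v w := v ≠ w ∧ IsExtreme ℝ D (segment ℝ (v : EuclideanSpace ℝ (Fin n)) w)
  symm := ⟨fun v w h => ⟨h.1.symm, by rw [segment_symm]; exact h.2⟩⟩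
  loopless := ⟨fun _ h => h.1 rfl⟩

/-- The label of the edge `[v, w]`: the minimal value of `G` on it. -/
noncomputable def edgeLabel {n : ℕ} (G : EuclideanSpace ℝ (Fin n) → ℝ)
    (v w : EuclideanSpace ℝ (Fin n)) : ℝ :=
  sInf (G '' segment ℝ v w)

/-- The sublevel set `U_g = {x ∈ D | G x < g}`. -/
def sublevel {n : ℕ} (D : Set (EuclideanSpace ℝ (Fin n)))
    (G : EuclideanSpace ℝ (Fin n) → ℝ) (g : ℝ) : Set (EuclideanSpace ℝ (Fin n)) :=
  {x ∈ D | G x < g}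

/-- The graph of the 1-skeleton without `U_g`: it consists of the vertices `v` with label
`G v ≥ g` and the edges whose label is `≥ g`. -/
def cutGraph {n : ℕ} (D : Set (EuclideanSpace ℝ (Fin n)))
    (G : EuclideanSpace ℝ (Fin n) → ℝ) (g : ℝ) :
    SimpleGraph {v : D.extremePoints ℝ // g ≤ G v} where
  Adj v w := (skeletonGraph D).Adj v.1 w.1 ∧ g ≤ edgeLabel G v.1 w.1
  symm := ⟨fun v w h => ⟨h.1.symm, by
    have h2 := h.2
    unfold edgeLabel at h2 ⊢
    rwa [segment_symm]⟩⟩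
  loopless := ⟨fun _ h => h.1.1 rfl⟩

/-- `M` is the set of vertices of a connected component of the graph of the 1-skeleton
without `U_g`. -/
def IsComponentVertexSet {n : ℕ} (D : Set (EuclideanSpace ℝ (Fin n)))
    (G : EuclideanSpace ℝ (Fin n) → ℝ) (g : ℝ) (M : Set (EuclideanSpace ℝ (Fin n))) : Prop :=
  ∃ C : (cutGraph D G g).ConnectedComponent,
    M = (fun v : {v : D.extremePoints ℝ // g ≤ G v} => (v.1 : EuclideanSpace ℝ (Fin n))) '' C.supp

/-- The space of pairs `(g, M)` with `min_D G ≤ g ≤ max_D G` and `M` the vertex set of a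
connected component of the graph of the 1-skeleton without `U_g`. -/
def CoordSpace {n : ℕ} (D : Set (EuclideanSpace ℝ (Fin n)))
    (G : EuclideanSpace ℝ (Fin n) → ℝ) : Type :=
  {p : ℝ × Set (EuclideanSpace ℝ (Fin n)) //
    p.1 ∈ Icc (sInf (G '' D)) (sSup (G '' D)) ∧ IsComponentVertexSet D G p.1 p.2}

/-- The basic neighbourhood
`V_ρ(g, M) = {(g', M') | |g - g'| < ρ, M' ⊆ M}` of the point `(g, M)`. -/
def CoordSpace.basicNhd {n : ℕ} {D : Set (EuclideanSpace ℝ (Fin n))}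
    {G : EuclideanSpace ℝ (Fin n) → ℝ} (p : CoordSpace D G) (ρ : ℝ) : Set (CoordSpace D G) :=
  {q | |p.1.1 - q.1.1| < ρ ∧ q.1.2 ⊆ p.1.2}

/-- The topology in which the `V_ρ(p)`, `ρ > 0`, form a fundamental system of neighbourhoods of
each point `p` (see `CoordSpace.nhds_hasBasis`). -/
instance CoordSpace.topology {n : ℕ} (D : Set (EuclideanSpace ℝ (Fin n)))
    (G : EuclideanSpace ℝ (Fin n) → ℝ) : TopologicalSpace (CoordSpace D G) where
  IsOpen s := ∀ p ∈ s, ∃ ρ > 0, p.basicNhd ρ ⊆ s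
  isOpen_univ _ _ := ⟨1, one_pos, subset_univ _⟩
  isOpen_inter s t hs ht p hp := by
    obtain ⟨ρ, hρ, h⟩ := hs p hp.1
    obtain ⟨σ, hσ, k⟩ := ht p hp.2
    exact ⟨min ρ σ, lt_min hρ hσ, fun q hq =>
      ⟨h ⟨hq.1.trans_le (min_le_left _ _), hq.2⟩, k ⟨hq.1.trans_le (min_le_right _ _), hq.2⟩⟩⟩
  isOpen_sUnion S hS p hp := by
    obtain ⟨s, hs, hps⟩ := hp
    obtain ⟨ρ, hρ, h⟩ := hS s hs p hps
    exact ⟨ρ, hρ, h.trans (subset_sUnion_of_mem hs)⟩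

theorem CoordSpace.nhds_hasBasis {n : ℕ} {D : Set (EuclideanSpace ℝ (Fin n))}
    {G : EuclideanSpace ℝ (Fin n) → ℝ} (p : CoordSpace D G) :
    (𝓝 p).HasBasis (fun ρ : ℝ => 0 < ρ) p.basicNhd := by
  refine ⟨fun s => ⟨fun hs => ?_, ?_⟩⟩
  · obtain ⟨t, hts, ht, hpt⟩ := mem_nhds_iff.mp hs
    obtain ⟨ρ, hρ, h⟩ := ht p hpt
    exact ⟨ρ, hρ, h.trans hts⟩
  · rintro ⟨ρ, hρ, h⟩
    refine mem_nhds_iff.mpr ⟨_, h, fun q hq => ?_, ⟨by simpa using hρ, subset_rfl⟩⟩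
    refine ⟨ρ - |p.1.1 - q.1.1|, sub_pos.mpr hq.1, fun r hr => ⟨?_, hr.2.trans hq.2⟩⟩
    have h1 := hr.1
    have h2 := abs_sub_le p.1.1 q.1.1 r.1.1
    linarith

/-- `(g', M') ≤ (g, M)` means `(g, M) ≿ (g', M')`, that is, `g ≥ g'` and `M ⊆ M'`. -/
instance CoordSpace.order {n : ℕ} (D : Set (EuclideanSpace ℝ (Fin n)))
    (G : EuclideanSpace ℝ (Fin n) → ℝ) : PartialOrder (CoordSpace D G) where
  le q p := q.1.1 ≤ p.1.1 ∧ p.1.2 ⊆ q.1.2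
  le_refl _ := ⟨le_rfl, subset_rfl⟩
  le_trans _ _ _ h k := ⟨h.1.trans k.1, k.2.trans h.2⟩
  le_antisymm _ _ h k := Subtype.ext (Prod.ext (h.1.antisymm k.1) (k.2.antisymm h.2))

end Coordinates

section UpperComponent

/-- The image `θ_g(W)` of a set `W ⊆ D \ U_g` under the central projection `θ_g` towards the
minimizer `x*` of `G` in `D`: `θ_g(y)` is the point `z ∈ [x*, y]` with `G z = g`. -/
def projImage {n : ℕ} (D : Set (EuclideanSpace ℝ (Fin n)))
    (G : EuclideanSpace ℝ (Fin n) → ℝ) (g : ℝ) (W : Set (EuclideanSpace ℝ (Fin n))) :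
    Set (EuclideanSpace ℝ (Fin n)) :=
  {z | ∃ xmin ∈ D, IsMinOn G D xmin ∧ ∃ y ∈ W, z ∈ segment ℝ xmin y ∧ G z = g}

/-- `W` is a path-connected component of `D \ U_g`, `g = G x`, with `θ_g(W) = [x]`, where `[x]`
is the class of `x` for `∼`. -/
def IsUpperComponent {n : ℕ} (D : Set (EuclideanSpace ℝ (Fin n)))
    (G : EuclideanSpace ℝ (Fin n) → ℝ) (x : D) (W : Set (EuclideanSpace ℝ (Fin n))) : Prop :=
  (∃ y ∈ D \ sublevel D G (G x), W = pathComponentIn (D \ sublevel D G (G x)) y) ∧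
    projImage D G (G x) W = Subtype.val '' {y : D | precedesSetoid D G x y}

end UpperComponent

/-! The relation `≿` only sees path components of superlevel sets: sliding towards the minimizer
retracts `D \ U_g` continuously onto the level set of `g`, so `x ≿ y` iff `G y ≤ G x` and both
points lie in one path component of `D \ U_{G y}` (`IsStrictlyConvexIn.precedes_iff`).

These components are then read off from the skeleton. Every point of `D \ U_g` is joined to a vertex
in its own superlevel set, and vertices joined by a path in `D \ U_g` are already joined in the cut
graph (`IsBoundedPolyhedron.reachable_of_joinedIn`). For the latter, each point of the path is
separated from the convex set `{G ≤ g'}`, with `g'` slightly below `g`, by a hyperplane depending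
continuously on the point. The cap of `D` beyond it contains vertices, which span a connected
subgraph by a simplex-method argument (`IsBoundedPolyhedron.preconnected_induce_halfSpace`). The
graph component met by the cap is locally constant along the path.

Hence `ω` induces an order-isomorphic bijection on the quotient. It is continuous because no label
lies in `[g', g)`, and a continuous bijection from a compact space to a Hausdorff space is a
homeomorphism. -/

/-! ### Polyhedra and their vertices. -/

theorem IsBoundedPolyhedron.isCompact {n : ℕ} {D : Set (EuclideanSpace ℝ (Fin n))}
    (hD : IsBoundedPolyhedron D) : IsCompact D := by
  obtain ⟨s, rfl⟩ := hD
  exact s.finite_toSet.isCompact_convexHull ℝ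

theorem IsBoundedPolyhedron.convex {n : ℕ} {D : Set (EuclideanSpace ℝ (Fin n))}
    (hD : IsBoundedPolyhedron D) : Convex ℝ D := by
  obtain ⟨s, rfl⟩ := hD
  exact convex_convexHull ℝ _

theorem IsBoundedPolyhedron.finite_extremePoints {n : ℕ} {D : Set (EuclideanSpace ℝ (Fin n))}
    (hD : IsBoundedPolyhedron D) : (D.extremePoints ℝ).Finite := by
  obtain ⟨s, rfl⟩ := hD
  exact s.finite_toSet.subset extremePoints_convexHull_subset

theorem IsBoundedPolyhedron.convexHull_extremePoints {n : ℕ}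
    {D : Set (EuclideanSpace ℝ (Fin n))} (hD : IsBoundedPolyhedron D) :
    convexHull ℝ (D.extremePoints ℝ) = D := by
  rw [← (hD.finite_extremePoints.isClosed_convexHull ℝ).closure_eq,
    closure_convexHull_extremePoints hD.isCompact hD.convex]

/-- A convex set containing all vertices of a polyhedron contains the polyhedron. -/
theorem IsBoundedPolyhedron.subset_of_extremePoints_subset {n : ℕ}
    {D C : Set (EuclideanSpace ℝ (Fin n))} (hD : IsBoundedPolyhedron D) (hC : Convex ℝ C)
    (h : D.extremePoints ℝ ⊆ C) : D ⊆ C := by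
  rw [← hD.convexHull_extremePoints]
  exact convexHull_min h hC

/-- Every linear functional attains at some vertex a value at least as large as at a given
point. -/
theorem IsBoundedPolyhedron.exists_extremePoint_ge {n : ℕ} {D : Set (EuclideanSpace ℝ (Fin n))}
    (hD : IsBoundedPolyhedron D) (l : EuclideanSpace ℝ (Fin n) →L[ℝ] ℝ)
    {x : EuclideanSpace ℝ (Fin n)} (hx : x ∈ D) : ∃ v ∈ D.extremePoints ℝ, l x ≤ l v := by
  by_contra! h
  exact lt_irrefl (l x) (hD.subset_of_extremePoints_subset
    (C := {y | l y < l x}) (convex_halfSpace_lt l.isLinear _) h hx)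

/-- Every vertex of a polyhedron is exposed. -/
theorem IsBoundedPolyhedron.exists_forall_lt {n : ℕ} {D : Set (EuclideanSpace ℝ (Fin n))}
    (hD : IsBoundedPolyhedron D) {v : EuclideanSpace ℝ (Fin n)} (hv : v ∈ D.extremePoints ℝ) :
    ∃ h : EuclideanSpace ℝ (Fin n) →L[ℝ] ℝ, ∀ u ∈ D.extremePoints ℝ, u ≠ v → h u < h v := by
  have hfin : (D.extremePoints ℝ \ {v}).Finite := hD.finite_extremePoints.subset sdiff_subset
  -- Otherwise the other vertices would generate `D`, but every generating set contains all extreme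
  -- points.
  have hmem : v ∉ convexHull ℝ (D.extremePoints ℝ \ {v}) := by
    intro hmem
    have hsub : D ⊆ convexHull ℝ (D.extremePoints ℝ \ {v}) := by
      refine hD.subset_of_extremePoints_subset (convex_convexHull ℝ _) fun u hu => ?_
      by_cases huv : u = v
      · rwa [huv]
      · exact subset_convexHull ℝ _ ⟨hu, huv⟩
    have heq : convexHull ℝ (D.extremePoints ℝ \ {v}) = D :=
      (convexHull_min (fun u hu => hu.1.1) hD.convex).antisymm hsub
    rw [← heq] at hv
    exact (extremePoints_convexHull_subset hv).2 rfl
  obtain ⟨h, a, h1, h2⟩ := geometric_hahn_banach_closed_point (convex_convexHull ℝ _)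
    (hfin.isClosed_convexHull ℝ) hmem
  exact ⟨h, fun u hu huv => (h1 u (subset_convexHull ℝ _ ⟨hu, huv⟩)).trans h2⟩

/-! ### Vertex figures, and connectedness of the skeleton in half-spaces. -/

/-- Extremality with unnormalized weights: when a multiple of `e` is split along `p` and `q`, each
term vanishes or points along `e`. -/
theorem eq_zero_or_eq_of_mem_extremePoints {E : Type*} [AddCommGroup E] [Module ℝ E]
    {Q : Set E} {e p q : E} (he : e ∈ Q.extremePoints ℝ) (hp : p ∈ Q) (hq : q ∈ Q) {a b : ℝ}
    (ha : 0 ≤ a) (hb : 0 ≤ b) (h : (a + b) • e = a • p + b • q) : a = 0 ∨ p = e := by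
  rcases ha.eq_or_lt with rfl | ha
  · exact Or.inl rfl
  right
  rcases hb.eq_or_lt with rfl | hb
  · have : a • e = a • p := by simpa using h
    exact (smul_right_injective E ha.ne' this).symm
  · refine he.2 hp hq ⟨a / (a + b), b / (a + b), by positivity, by positivity,
      by field_simp, ?_⟩
    have hne : a + b ≠ 0 := by positivity
    rw [div_eq_inv_mul, div_eq_inv_mul, mul_smul, mul_smul, ← smul_add, ← h, smul_smul,
      inv_mul_cancel₀ hne, one_smul]

/-- The cone with apex `v` over `Q`, truncated at height `R` in the direction of an extreme point
`e` of `Q`, is convex. -/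
theorem convex_truncated_cone {E : Type*} [AddCommGroup E] [Module ℝ E] {Q : Set E} {v e : E}
    (hQ : Convex ℝ Q) (he : e ∈ Q.extremePoints ℝ) {R : ℝ} (hR : 0 ≤ R) :
    Convex ℝ {x | ∃ r : ℝ, 0 ≤ r ∧ ∃ q ∈ Q, x = v + r • q ∧ (q = e → r ≤ R)} := by
  rintro _ ⟨r, hr, p, hp, rfl, hpe⟩ _ ⟨s, hs, q, hq, rfl, hqe⟩ a b ha hb hab
  have hα : 0 ≤ a * r := by positivity
  have hβ : 0 ≤ b * s := by positivity
  have hsum : a • (v + r • p) + b • (v + s • q) = v + ((a * r) • p + (b * s) • q) := by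
    have : v = (a + b) • v := by rw [hab, one_smul]
    conv_rhs => rw [this]
    module
  rw [hsum]
  rcases (add_nonneg hα hβ).eq_or_lt with h0 | hpos
  · have h1 : a * r = 0 := by linarith
    have h2 : b * s = 0 := by linarith
    exact ⟨0, le_rfl, p, hp, by simp [h1, h2], fun _ => hR⟩
  · have hne := hpos.ne'
    have hcomb : (a * r + b * s) • ((a * r / (a * r + b * s)) • p +
        (b * s / (a * r + b * s)) • q) = (a * r) • p + (b * s) • q := by
      rw [smul_add, smul_smul, smul_smul, mul_div_cancel₀ _ hne, mul_div_cancel₀ _ hne]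
    refine ⟨a * r + b * s, hpos.le, _, hQ hp hq (div_nonneg hα hpos.le) (div_nonneg hβ hpos.le)
      (by field_simp), by rw [hcomb], fun h => ?_⟩
    -- The bound `R` matters only if the combination lands on the ray through `e`; by extremality
    -- each term then vanishes or is on that ray, where its height is at most `R`.
    rw [h] at hcomb
    have h1 : a * r ≤ a * R := by
      rcases eq_zero_or_eq_of_mem_extremePoints he hp hq hα hβ hcomb with h | h
      · rw [h]; positivity
      · exact mul_le_mul_of_nonneg_left (hpe h) ha
    have h2 : b * s ≤ b * R := by
      rcases eq_zero_or_eq_of_mem_extremePoints he hq hp hβ hα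
        (by rw [add_comm, hcomb, add_comm]) with h | h
      · rw [h]; positivity
      · exact mul_le_mul_of_nonneg_left (hqe h) hb
    calc a * r + b * s ≤ a * R + b * R := add_le_add h1 h2
      _ = R := by rw [← add_mul, hab, one_mul]

/-- A vertex which does not maximize a linear functional has a neighbour with a larger value. -/
theorem IsBoundedPolyhedron.exists_adj_lt {n : ℕ} {D : Set (EuclideanSpace ℝ (Fin n))}
    (hD : IsBoundedPolyhedron D) (l : EuclideanSpace ℝ (Fin n) →L[ℝ] ℝ)
    (v w : D.extremePoints ℝ) (hvw : l v < l w) :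
    ∃ u : D.extremePoints ℝ, (skeletonGraph D).Adj v u ∧ l v < l u := by
  obtain ⟨v, hv⟩ := v
  obtain ⟨w, hw⟩ := w
  simp only at hvw
  obtain ⟨h', hh'⟩ := hD.exists_forall_lt hv
  obtain ⟨h, hh⟩ : ∃ h : EuclideanSpace ℝ (Fin n) →L[ℝ] ℝ,
      ∀ u ∈ D.extremePoints ℝ, u ≠ v → 0 < h u - h v :=
    ⟨-h', fun u hu huv => by simpa using hh' u hu huv⟩
  -- `h` is positive on all directions `u - v`; scaling them to `h = 1` makes `Q` the vertex figure
  -- of `D` at `v`, whose extreme points are the edge directions.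
  set d : EuclideanSpace ℝ (Fin n) → EuclideanSpace ℝ (Fin n) :=
    fun u => (h u - h v)⁻¹ • (u - v) with hd
  set T := D.extremePoints ℝ \ {v} with hT
  have hTfin : T.Finite := hD.finite_extremePoints.subset sdiff_subset
  set Q := convexHull ℝ (d '' T) with hQ
  have hQc : IsCompact Q := (hTfin.image d).isCompact_convexHull ℝ
  have hwv : w ≠ v := by rintro rfl; exact lt_irrefl _ hvw
  have hdw : d w ∈ Q := subset_convexHull ℝ _ ⟨w, ⟨hw, hwv⟩, rfl⟩
  have hQh : ∀ q ∈ Q, h q = 1 := by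
    intro q hq
    refine convexHull_min (t := {q | h q = 1}) ?_ (convex_hyperplane h.isLinear 1) hq
    rintro _ ⟨u, hu, rfl⟩
    have := hh u hu.1 hu.2
    simp only [hd, mem_ofPred_eq, map_smul, map_sub, smul_eq_mul]
    exact inv_mul_cancel₀ this.ne'
  have hld : ∀ u ∈ T, l v < l u ↔ 0 < l (d u) := by
    intro u hu
    have := hh u hu.1 hu.2
    simp only [hd, map_smul, map_sub, smul_eq_mul]
    rw [mul_pos_iff_of_pos_left (inv_pos.mpr this), sub_pos]
  -- An extreme point of the face of `Q` where `l` is maximal does the job: its value is at least `l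
  -- (d w) > 0`.
  obtain ⟨e, he, hle⟩ : ∃ e ∈ Q.extremePoints ℝ, 0 < l e := by
    have hexp : IsExposed ℝ Q (l.toExposed Q) := ContinuousLinearMap.toExposed.isExposed
    obtain ⟨q, hq, hmax⟩ := hQc.exists_isMaxOn ⟨_, hdw⟩ l.continuous.continuousOn
    obtain ⟨e, he⟩ := (hexp.isCompact hQc).extremePoints_nonempty ⟨q, hq, hmax⟩
    refine ⟨e, hexp.isExtreme.extremePoints_subset_extremePoints he, ?_⟩
    exact ((hld w ⟨hw, hwv⟩).1 hvw).trans_le (he.1.2 _ hdw)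
  obtain ⟨u0, hu0T, hu0e⟩ : e ∈ d '' T := extremePoints_convexHull_subset he
  -- The farthest vertex on the ray from `v` along `e`, so that `D` meets this ray only in `[v, u]`.
  obtain ⟨u, ⟨huT, hue⟩, humax⟩ := Set.exists_max_image {u ∈ T | d u = e} h
    (hTfin.subset (sep_subset _ _)) ⟨u0, hu0T, hu0e⟩
  have hR := hh u huT.1 huT.2
  have huv : u = v + (h u - h v) • e := by
    rw [← hue]
    simp only [hd]
    rw [smul_smul, mul_inv_cancel₀ hR.ne', one_smul, add_sub_cancel]
  have hcone := hD.subset_of_extremePoints_subset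
    (convex_truncated_cone (v := v) (convex_convexHull ℝ _) he hR.le) (by
      intro z hz
      by_cases hzv : z = v
      · exact ⟨0, le_rfl, d w, hdw, by simp [hzv], fun _ => hR.le⟩
      · have hpos := hh z hz hzv
        refine ⟨h z - h v, hpos.le, d z, subset_convexHull ℝ _ ⟨z, ⟨hz, hzv⟩, rfl⟩, ?_, ?_⟩
        · simp only [hd]
          rw [smul_smul, mul_inv_cancel₀ hpos.ne', one_smul, add_sub_cancel]
        · intro hze
          have := humax z ⟨⟨hz, hzv⟩, hze⟩
          linarith)
  have hseg : ∀ r : ℝ, 0 ≤ r → r ≤ h u - h v → v + r • e ∈ segment ℝ v u := by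
    intro r hr hrR
    rw [segment_eq_image']
    refine ⟨r / (h u - h v), ⟨by positivity, (div_le_one hR).mpr hrR⟩, ?_⟩
    have : u - v = (h u - h v) • e := by
      nth_rewrite 1 [huv]; rw [add_sub_cancel_left]
    simp only
    rw [this, smul_smul, div_mul_cancel₀ _ hR.ne']
  refine ⟨⟨u, huT.1⟩, ⟨fun hvu => huT.2 (congrArg Subtype.val hvu).symm, ?_, ?_⟩, ?_⟩
  · exact hD.convex.segment_subset hv.1 huT.1.1
  · rintro x hx y hy z hz ⟨a, b, ha, hb, hab, rfl⟩
    obtain ⟨r, hr, p, hp, rfl, hpe⟩ := hcone hx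
    obtain ⟨s, hs, q, hq, rfl, hqe⟩ := hcone hy
    obtain ⟨t, ⟨ht0, ht1⟩, hz⟩ := (segment_eq_image' ℝ v u).subset hz
    have hz2 : (t * (h u - h v)) • e = (a * r) • p + (b * s) • q := by
      have h3 : v = (a + b) • v := by rw [hab, one_smul]
      have h4 : u - v = (h u - h v) • e := by
        nth_rewrite 1 [huv]; rw [add_sub_cancel_left]
      simp only at hz
      rw [h4] at hz
      have h5 : a • (v + r • p) + b • (v + s • q) = v + ((a * r) • p + (b * s) • q) := by
        conv_rhs => rw [h3]
        module
      rw [h5] at hz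
      rw [← add_left_cancel hz, smul_smul]
    -- As `h = 1` on `Q`, applying `h` compares the coefficients, and extremality of `e` becomes
    -- applicable.
    have hh2 : t * (h u - h v) = a * r + b * s := by
      have := congrArg h hz2
      simpa [hQh e he.1, hQh p hp, hQh q hq] using this
    rw [hh2] at hz2
    rcases eq_zero_or_eq_of_mem_extremePoints he hp hq (mul_nonneg ha.le hr)
      (mul_nonneg hb.le hs) hz2 with h0 | rfl
    · have : r = 0 := by simpa [ha.ne'] using h0
      simp [this, left_mem_segment]
    · exact hseg r hr (hpe rfl)
  · exact (hld u huT).2 (by rwa [hue])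

/-- If a vertex `w` is the unique maximizer of a linear functional, then it can be reached from
any vertex along edges on which the functional increases. -/
theorem IsBoundedPolyhedron.reachable_of_forall_lt {n : ℕ}
    {D : Set (EuclideanSpace ℝ (Fin n))} (hD : IsBoundedPolyhedron D)
    (l : EuclideanSpace ℝ (Fin n) →L[ℝ] ℝ) (w : D.extremePoints ℝ)
    (hw : ∀ u : D.extremePoints ℝ, u ≠ w → l u < l w)
    (P : Set (D.extremePoints ℝ)) (hP : ∀ v ∈ P, ∀ u : D.extremePoints ℝ, l v < l u → u ∈ P)
    (hwP : w ∈ P) (v : P) : ((skeletonGraph D).induce P).Reachable v ⟨w, hwP⟩ := by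
  have := hD.finite_extremePoints.to_subtype
  by_contra hv
  -- A counterexample with the largest value of `l`: its neighbour with a larger value does reach
  -- `w`.
  obtain ⟨u, hu, hmax⟩ := Set.exists_max_image
    {u : P | ¬ ((skeletonGraph D).induce P).Reachable u ⟨w, hwP⟩} (fun u => l u) (toFinite _)
    ⟨v, hv⟩
  have huw : u.1 ≠ w := by
    rintro h
    exact hu (by rw [show u = ⟨w, hwP⟩ from Subtype.ext h])
  obtain ⟨z, hadj, hlt⟩ := hD.exists_adj_lt l u.1 w (hw _ huw)
  have hz : z ∈ P := hP u.1 u.2 z hlt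
  have hzr : ((skeletonGraph D).induce P).Reachable ⟨z, hz⟩ ⟨w, hwP⟩ := by
    by_contra hzr
    exact absurd (hmax ⟨z, hz⟩ hzr) (not_le.mpr hlt)
  have hadj' : ((skeletonGraph D).induce P).Adj u ⟨z, hz⟩ := hadj
  exact hu (hadj'.reachable.trans hzr)

/-- The vertices of a polyhedron in a closed half-space span a connected subgraph of the
1-skeleton. -/
theorem IsBoundedPolyhedron.preconnected_induce_halfSpace {n : ℕ}
    {D : Set (EuclideanSpace ℝ (Fin n))} (hD : IsBoundedPolyhedron D)
    (l : EuclideanSpace ℝ (Fin n) →L[ℝ] ℝ) (c : ℝ) :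
    ((skeletonGraph D).induce {v : D.extremePoints ℝ | c ≤ l v}).Preconnected := by
  have hfin := hD.finite_extremePoints.to_subtype
  intro v v'
  obtain ⟨w, -, hw⟩ := Set.exists_max_image (univ : Set (D.extremePoints ℝ)) (fun u => l u)
    finite_univ ⟨v.1, trivial⟩
  have hwc : w ∈ {v : D.extremePoints ℝ | c ≤ l v} := le_trans v.2 (hw v.1 trivial)
  obtain ⟨m, hm⟩ := hD.exists_forall_lt w.2
  -- The maximizer of `l` need not be unique, so `l` is perturbed by a functional `m` exposing `w`.
  -- For small `ε` an ascent of `l + ε • m` still cannot leave the half-space, since only finitely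
  -- many strict inequalities are involved.
  obtain ⟨ε, hε, hεc⟩ : ∃ ε : ℝ, 0 < ε ∧ ∀ u z : D.extremePoints ℝ,
      l u < c → c ≤ l z → l u + ε * m u < l z + ε * m z := by
    have hev : ∀ᶠ ε : ℝ in 𝓝[>] 0, ∀ u z : D.extremePoints ℝ,
        l u < c → c ≤ l z → l u + ε * m u < l z + ε * m z := by
      rw [Filter.eventually_all]
      intro u
      rw [Filter.eventually_all]
      intro z
      by_cases huz : l u < c ∧ c ≤ l z
      · have hc : Filter.Tendsto (fun ε : ℝ => (l z + ε * m z) - (l u + ε * m u)) (𝓝 0)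
            (𝓝 ((l z + 0 * m z) - (l u + 0 * m u))) :=
          (Continuous.tendsto (by fun_prop) 0)
        have hpos : 0 < (l z + 0 * m z) - (l u + 0 * m u) := by linarith [huz.1, huz.2]
        filter_upwards [(hc.eventually (lt_mem_nhds hpos)).filter_mono nhdsWithin_le_nhds]
          with ε hε _ _
        linarith
      · exact Filter.Eventually.of_forall fun ε h1 h2 => absurd ⟨h1, h2⟩ huz
    obtain ⟨ε, h1, h2⟩ := (hev.and self_mem_nhdsWithin).exists
    exact ⟨ε, h2, h1⟩
  have key := hD.reachable_of_forall_lt (l + ε • m) w (fun u hu => by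
      have h1 := hw u trivial
      have h2 := hm u u.2 (fun h => hu (Subtype.ext h))
      have h3 := mul_lt_mul_of_pos_left h2 hε
      simp only [add_apply, smul_apply, smul_eq_mul]
      linarith) {v : D.extremePoints ℝ | c ≤ l v} (fun z hz u hzu => by
      by_contra hu
      have := hεc u z (not_le.mp hu) hz
      simp only [add_apply, smul_apply,
        smul_eq_mul] at hzu
      linarith) hwc
  exact (key v).trans (key v').symm

/-! ### From paths in superlevel sets to paths in the graph. -/

/-- The points outside a closed convex set can be separated from it by linear functionals
depending continuously on the point. -/
theorem exists_continuous_separation {E : Type*} [NormedAddCommGroup E] [InnerProductSpace ℝ E]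
    [CompleteSpace E] {K : Set E} (hK : IsClosed K) (hKc : Convex ℝ K) :
    ∃ N : E → E, Continuous N ∧ ∀ x ∉ K, ∀ k ∈ K, inner ℝ (N x) k < inner ℝ (N x) x := by
  rcases K.eq_empty_or_nonempty with rfl | hne
  · exact ⟨fun _ => 0, continuous_const, by simp⟩
  -- `p` is the nearest-point projection onto `K`; its variational inequality makes it 1-Lipschitz,
  -- and `x - p x` is the separating normal.
  choose p hpK hp using exists_norm_eq_iInf_of_complete_convex hne hK.isComplete hKc
  have hp' : ∀ x, ∀ k ∈ K, inner ℝ (x - p x) (k - p x) ≤ 0 := fun x =>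
    (norm_eq_iInf_iff_real_inner_le_zero hKc (hpK x)).1 (hp x)
  have hlip : LipschitzWith 1 p := by
    refine LipschitzWith.of_dist_le_mul fun x y => ?_
    rw [NNReal.coe_one, one_mul, dist_eq_norm, dist_eq_norm]
    have h1 := hp' x _ (hpK y)
    have h2 := hp' y _ (hpK x)
    have h3 : inner ℝ (p x - p y) (p x - p y) ≤ inner ℝ (x - y) (p x - p y) := by
      simp only [inner_sub_left, inner_sub_right] at h1 h2 ⊢
      linarith
    rw [real_inner_self_eq_norm_mul_norm] at h3
    have h4 := h3.trans (real_inner_le_norm _ _)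
    rcases (norm_nonneg (p x - p y)).eq_or_lt with h0 | h0
    · rw [← h0]; exact norm_nonneg _
    · exact le_of_mul_le_mul_right h4 h0
  refine ⟨fun x => x - p x, continuous_id.sub hlip.continuous, fun x hx k hk => ?_⟩
  have h1 := hp' x k hk
  have h2 : 0 < inner ℝ (x - p x) (x - p x) := by
    rw [real_inner_self_eq_norm_mul_norm]
    have : 0 < ‖x - p x‖ := norm_pos_iff.mpr (sub_ne_zero.mpr fun h => hx (h ▸ hpK x))
    positivity
  rw [inner_sub_right] at h1 h2
  linarith

/-- Below every value `g` there is an interval `[g', g)` without labels. -/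
theorem IsBoundedPolyhedron.exists_label_gap {n : ℕ} {D : Set (EuclideanSpace ℝ (Fin n))}
    (hD : IsBoundedPolyhedron D) (G : EuclideanSpace ℝ (Fin n) → ℝ) (g : ℝ) :
    ∃ g' < g, (∀ v ∈ D.extremePoints ℝ, g' ≤ G v → g ≤ G v) ∧
      ∀ v ∈ D.extremePoints ℝ, ∀ w ∈ D.extremePoints ℝ,
        g' ≤ edgeLabel G v w → g ≤ edgeLabel G v w := by
  have hfin := hD.finite_extremePoints
  have key : ∀ a : ℝ, ∀ᶠ g' in 𝓝[<] g, g' ≤ a → g ≤ a := by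
    intro a
    by_cases ha : g ≤ a
    · exact Filter.Eventually.of_forall fun _ _ => ha
    · filter_upwards [(lt_mem_nhds (not_le.mp ha)).filter_mono nhdsWithin_le_nhds] with g' h1 h2
      exact absurd h2 (not_le.mpr h1)
  have h1 := (Filter.eventually_all_finite hfin).2 fun v _ => key (G v)
  have h2 := (Filter.eventually_all_finite hfin).2 fun v _ =>
    (Filter.eventually_all_finite hfin).2 fun w _ => key (edgeLabel G v w)
  obtain ⟨g', h, hlt⟩ := ((h1.and h2).and self_mem_nhdsWithin).exists
  exact ⟨g', hlt, h.1, h.2⟩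

/-- The vertices in a closed half-space on which `G > g'` lie in one component of the graph of
the 1-skeleton without `U_g`, if there are no labels in `[g', g)`. -/
theorem IsBoundedPolyhedron.reachable_of_halfSpace {n : ℕ}
    {D : Set (EuclideanSpace ℝ (Fin n))} (hD : IsBoundedPolyhedron D)
    {G : EuclideanSpace ℝ (Fin n) → ℝ} {g g' : ℝ}
    (hv : ∀ v ∈ D.extremePoints ℝ, g' ≤ G v → g ≤ G v)
    (he : ∀ v ∈ D.extremePoints ℝ, ∀ w ∈ D.extremePoints ℝ,
      g' ≤ edgeLabel G v w → g ≤ edgeLabel G v w)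
    {l : EuclideanSpace ℝ (Fin n) →L[ℝ] ℝ} {c : ℝ} (hl : ∀ z ∈ D, c ≤ l z → g' ≤ G z)
    {v w : {v : D.extremePoints ℝ // g ≤ G v}} (hvc : c ≤ l v.1) (hwc : c ≤ l w.1) :
    (cutGraph D G g).Reachable v w := by
  let f : (skeletonGraph D).induce {v : D.extremePoints ℝ | c ≤ l v} →g cutGraph D G g :=
    { toFun := fun u => ⟨u.1, hv _ u.1.2 (hl _ u.1.2.1 u.2)⟩
      map_rel' := by
        rintro ⟨a, ha⟩ ⟨b, hb⟩ hab
        refine ⟨hab, he _ a.2 _ b.2 (le_csInf (Set.Nonempty.image G ⟨_, left_mem_segment ℝ _ _⟩) ?_)⟩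
        rintro _ ⟨z, hz, rfl⟩
        exact hl z (hD.convex.segment_subset a.2.1 b.2.1 hz)
          ((convex_halfSpace_ge l.isLinear c).segment_subset ha hb hz) }
  exact (hD.preconnected_induce_halfSpace l c ⟨v.1, hvc⟩ ⟨w.1, hwc⟩).map f

/-- Vertices which can be joined in `{G > g'}` lie in one component of the graph of the
1-skeleton without `U_g`, if there are no labels in `[g', g)`. -/
theorem IsBoundedPolyhedron.reachable_of_joinedIn {n : ℕ}
    {D : Set (EuclideanSpace ℝ (Fin n))} (hD : IsBoundedPolyhedron D)
    {G : EuclideanSpace ℝ (Fin n) → ℝ} (hcont : ContinuousOn G D) (hconv : ConvexOn ℝ D G)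
    {g g' : ℝ} (hv : ∀ v ∈ D.extremePoints ℝ, g' ≤ G v → g ≤ G v)
    (he : ∀ v ∈ D.extremePoints ℝ, ∀ w ∈ D.extremePoints ℝ,
      g' ≤ edgeLabel G v w → g ≤ edgeLabel G v w)
    {v w : {v : D.extremePoints ℝ // g ≤ G v}}
    (hvw : JoinedIn {z ∈ D | g' < G z} (v.1 : EuclideanSpace ℝ (Fin n)) w.1) :
    (cutGraph D G g).Reachable v w := by
  have hVfin := hD.finite_extremePoints.to_subtype
  have hKc : IsClosed {z ∈ D | G z ≤ g'} :=
    hcont.preimage_isClosed_of_isClosed hD.isCompact.isClosed isClosed_Iic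
  obtain ⟨N, hN, hsep⟩ := exists_continuous_separation hKc (hconv.convex_le g')
  have hcap : ∀ x ∈ {z ∈ D | g' < G z}, ∀ z ∈ D,
      innerSL ℝ (N x) x ≤ innerSL ℝ (N x) z → g' ≤ G z := by
    intro x hx z hz hxz
    by_contra hlt
    exact absurd (hsep x (fun h => not_le.mpr hx.2 h.2) z ⟨hz, (not_le.mp hlt).le⟩)
      (not_lt.mpr hxz)
  obtain ⟨γ, hγ⟩ := hvw
  -- The vertices in the cap of `D` beyond the hyperplane through `γ t`.
  let S : unitInterval → Set {v : D.extremePoints ℝ // g ≤ G v} := fun t =>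
    {u | innerSL ℝ (N (γ t)) (γ t) ≤ innerSL ℝ (N (γ t)) u.1}
  have hS : ∀ t, ∀ a ∈ S t, ∀ b ∈ S t, (cutGraph D G g).Reachable a b := fun t a ha b hb =>
    hD.reachable_of_halfSpace hv he (hcap _ (hγ t)) ha hb
  have hSne : ∀ t, (S t).Nonempty := by
    intro t
    obtain ⟨u, hu, hle⟩ := hD.exists_extremePoint_ge (innerSL ℝ (N (γ t))) (hγ t).1
    exact ⟨⟨⟨u, hu⟩, hv u hu (hcap _ (hγ t) u hu.1 hle)⟩, hle⟩
  -- The inequality defining the cap is closed and there are finitely many vertices, so vertices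
  -- outside the cap stay outside for nearby parameters.
  have hSev : ∀ t, ∀ᶠ s in 𝓝 t, S s ⊆ S t := by
    intro t
    have : ∀ᶠ s in 𝓝 t, ∀ u, u ∈ S s → u ∈ S t := by
      rw [Filter.eventually_all]
      intro u
      by_cases hu : u ∈ S t
      · exact Filter.Eventually.of_forall fun _ _ => hu
      · have hu' : innerSL ℝ (N (γ t)) u.1 < innerSL ℝ (N (γ t)) (γ t) := not_le.mp hu
        have hc1 : Continuous fun s : unitInterval =>
            innerSL ℝ (N (γ s)) (u.1 : EuclideanSpace ℝ (Fin n)) := by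
          simp only [innerSL_apply_apply]; fun_prop
        have hc2 : Continuous fun s : unitInterval => innerSL ℝ (N (γ s)) (γ s) := by
          simp only [innerSL_apply_apply]; fun_prop
        filter_upwards [(isOpen_lt hc1 hc2).mem_nhds hu'] with s hs hs'
        exact absurd hs' (not_le.mpr hs)
    exact this
  have hconst : IsLocallyConstant fun t : unitInterval =>
      {u | ∃ s ∈ S t, (cutGraph D G g).Reachable u s} := by
    rw [IsLocallyConstant.iff_eventually_eq]
    intro t
    filter_upwards [hSev t] with t' ht'
    ext u
    constructor
    · rintro ⟨s, hs, hus⟩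
      exact ⟨s, ht' hs, hus⟩
    · rintro ⟨s, hs, hus⟩
      obtain ⟨s', hs'⟩ := hSne t'
      exact ⟨s', hs', hus.trans (hS t s hs s' (ht' hs'))⟩
  have h01 := hconst.apply_eq_of_isPreconnected isPreconnected_univ (mem_univ 0) (mem_univ 1)
  have hv0 : v ∈ S 0 := by simp [S]
  have hw1 : w ∈ S 1 := by simp [S]
  obtain ⟨s, hs, hvs⟩ := h01.subset ⟨v, hv0, .refl v⟩
  exact hvs.trans (hS 1 s hs w hw1)

/-! ### Central projection towards the minimizer. -/

theorem mem_sdiff_sublevel {n : ℕ} {D : Set (EuclideanSpace ℝ (Fin n))}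
    {G : EuclideanSpace ℝ (Fin n) → ℝ} {g : ℝ} {w : EuclideanSpace ℝ (Fin n)} :
    w ∈ D \ sublevel D G g ↔ w ∈ D ∧ g ≤ G w := by
  simp only [sublevel, mem_sdiff, mem_sep_iff, not_and, not_lt]
  exact ⟨fun h => ⟨h.1, h.2 h.1⟩, fun h => ⟨h.1, fun _ => h.2⟩⟩

theorem sdiff_sublevel_subset {n : ℕ} (D : Set (EuclideanSpace ℝ (Fin n)))
    (G : EuclideanSpace ℝ (Fin n) → ℝ) {g g' : ℝ} (h : g' ≤ g) :
    D \ sublevel D G g ⊆ D \ sublevel D G g' := fun _ hw =>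
  mem_sdiff_sublevel.2 ⟨hw.1, h.trans (mem_sdiff_sublevel.1 hw).2⟩

/-- A convex function does not decrease along rays starting at a minimizer. -/
theorem ConvexOn.monotoneOn_lineMap_of_isMinOn {n : ℕ} {D : Set (EuclideanSpace ℝ (Fin n))}
    {G : EuclideanSpace ℝ (Fin n) → ℝ} (hG : ConvexOn ℝ D G) {m y : EuclideanSpace ℝ (Fin n)}
    (hm : m ∈ D) (hmin : IsMinOn G D m) (hy : y ∈ D) :
    MonotoneOn (fun t : ℝ => G (AffineMap.lineMap m y t)) (Icc 0 1) := by
  intro s hs t ht hst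
  have hmem : ∀ r ∈ Icc (0 : ℝ) 1, AffineMap.lineMap m y r ∈ D := fun r hr =>
    hG.1.segment_subset hm hy (by rw [segment_eq_image_lineMap]; exact ⟨r, hr, rfl⟩)
  have hseg : AffineMap.lineMap m y s ∈ segment ℝ m (AffineMap.lineMap m y t) := by
    have h := image_segment ℝ (AffineMap.lineMap m y : ℝ →ᵃ[ℝ] EuclideanSpace ℝ (Fin n)) 0 t
    rw [AffineMap.lineMap_apply_zero, segment_eq_Icc (hs.1.trans hst)] at h
    rw [← h]
    exact ⟨s, ⟨hs.1, hst⟩, rfl⟩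
  exact (hG.le_max_of_mem_segment hm (hmem t ht) hseg).trans
    (max_le (hmin (hmem t ht)) le_rfl)

/-- On a segment starting at a minimizer, `G` takes each value at most once. -/
theorem IsStrictlyConvexIn.eq_of_mem_segment {n : ℕ} {D : Set (EuclideanSpace ℝ (Fin n))}
    {G : EuclideanSpace ℝ (Fin n) → ℝ} (hG : IsStrictlyConvexIn D G)
    {m y z z' : EuclideanSpace ℝ (Fin n)} (hm : m ∈ D) (hmin : IsMinOn G D m) (hy : y ∈ D)
    (hz : z ∈ segment ℝ m y) (hz' : z' ∈ segment ℝ m y) (h : G z = G z') : z = z' := by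
  have hmono := hG.1.monotoneOn_lineMap_of_isMinOn hm hmin hy
  have hzD := hG.1.1.segment_subset hm hy hz
  have hzD' := hG.1.1.segment_subset hm hy hz'
  rw [segment_eq_image_lineMap] at hz hz'
  obtain ⟨s, hs, rfl⟩ := hz
  obtain ⟨t, ht, rfl⟩ := hz'
  wlog hst : s ≤ t generalizing s t
  · exact (this t ht hzD' s hs hzD h.symm (le_of_not_ge hst)).symm
  by_contra hne
  refine hG.2 _ hzD _ hzD' hne ⟨G (AffineMap.lineMap m y s), fun w hw => ?_⟩
  rw [← image_segment, segment_eq_Icc hst] at hw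
  obtain ⟨r, hr, rfl⟩ := hw
  have hr01 : r ∈ Icc (0 : ℝ) 1 := ⟨hs.1.trans hr.1, hr.2.trans ht.2⟩
  exact ((hmono hr01 ht hr.2).trans_eq h.symm).antisymm (hmono hs hr01 hr.1)

theorem ConvexOn.antitone_lineMap_of_isMinOn {n : ℕ} {D : Set (EuclideanSpace ℝ (Fin n))}
    {G : EuclideanSpace ℝ (Fin n) → ℝ} (hG : ConvexOn ℝ D G) {m y z : EuclideanSpace ℝ (Fin n)}
    (hm : m ∈ D) (hmin : IsMinOn G D m) (hy : y ∈ D) (hz : z ∈ segment ℝ m y) :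
    AntitoneOn (fun t : ℝ => G (AffineMap.lineMap y z t)) (Icc 0 1) := by
  have hmono := hG.monotoneOn_lineMap_of_isMinOn hm hmin hy
  rw [segment_eq_image_lineMap] at hz
  obtain ⟨s, hs, rfl⟩ := hz
  have h : ∀ t : ℝ, AffineMap.lineMap y (AffineMap.lineMap m y s) t =
      AffineMap.lineMap m y (1 - t * (1 - s)) := by
    intro t
    simp only [AffineMap.lineMap_apply_module]
    module
  intro t ht u hu htu
  simp only [h]
  have h1s : 0 ≤ 1 - s := by linarith [hs.2]
  have hmem : ∀ r ∈ Icc (0 : ℝ) 1, 1 - r * (1 - s) ∈ Icc (0 : ℝ) 1 := fun r hr =>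
    ⟨by nlinarith [hr.1, hr.2, hs.1], by nlinarith [hr.1, hr.2, hs.1]⟩
  exact hmono (hmem u hu) (hmem t ht) (by nlinarith)

/-- Moving towards a minimizer of a convex function is a non-increasing path. -/
theorem ConvexOn.precedes_of_mem_segment {n : ℕ} {D : Set (EuclideanSpace ℝ (Fin n))}
    {G : EuclideanSpace ℝ (Fin n) → ℝ} (hG : ConvexOn ℝ D G) {m : EuclideanSpace ℝ (Fin n)}
    (hm : m ∈ D) (hmin : IsMinOn G D m) {y z : D}
    (hz : (z : EuclideanSpace ℝ (Fin n)) ∈ segment ℝ m y) : Precedes D G y z := by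
  have hanti := hG.antitone_lineMap_of_isMinOn hm hmin y.2 hz
  refine ⟨⟨⟨fun t => ⟨AffineMap.lineMap (y : EuclideanSpace ℝ (Fin n)) z (t : ℝ),
    hG.1.segment_subset y.2 z.2 ?_⟩, ?_⟩, ?_, ?_⟩, fun s t hst => hanti s.2 t.2 hst⟩
  · rw [segment_eq_image_lineMap]
    exact ⟨t, t.2, rfl⟩
  · exact (AffineMap.lineMap_continuous.comp continuous_subtype_val).subtype_mk _
  · simp
  · simp

theorem Precedes.joinedIn {n : ℕ} {D : Set (EuclideanSpace ℝ (Fin n))}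
    {G : EuclideanSpace ℝ (Fin n) → ℝ} {x y : D} (h : Precedes D G x y) :
    JoinedIn (D \ sublevel D G (G y)) (x : EuclideanSpace ℝ (Fin n)) y := by
  obtain ⟨φ, hφ⟩ := h
  refine ⟨φ.map continuous_subtype_val, fun t => mem_sdiff_sublevel.2 ⟨(φ t).2, ?_⟩⟩
  simpa using hφ (unitInterval.le_one' (t := t))

theorem Precedes.le {n : ℕ} {D : Set (EuclideanSpace ℝ (Fin n))}
    {G : EuclideanSpace ℝ (Fin n) → ℝ} {x y : D} (h : Precedes D G x y) : G y ≤ G x := by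
  obtain ⟨φ, hφ⟩ := h
  simpa using hφ (unitInterval.nonneg' (t := 1))

theorem exists_mem_segment_eq {n : ℕ} {D : Set (EuclideanSpace ℝ (Fin n))}
    {G : EuclideanSpace ℝ (Fin n) → ℝ} (hD : Convex ℝ D) (hcont : ContinuousOn G D)
    {m y : EuclideanSpace ℝ (Fin n)} (hm : m ∈ D) (hy : y ∈ D) {g : ℝ} (h1 : G m ≤ g)
    (h2 : g ≤ G y) : ∃ z ∈ segment ℝ m y, G z = g :=
  (convex_segment m y).isPreconnected.intermediate_value (left_mem_segment ℝ m y)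
    (right_mem_segment ℝ m y) (hcont.mono (hD.segment_subset hm hy)) ⟨h1, h2⟩

/-- Preimages of closed sets are projections of closed sets along a compact factor. This serves for
the central projection, which is characterized by closed conditions. -/
theorem continuous_of_isClosed_graph {X Y : Type*} [TopologicalSpace X] [TopologicalSpace Y]
    [CompactSpace Y] {f : X → Y} (hf : IsClosed {p : X × Y | p.2 = f p.1}) : Continuous f := by
  rw [continuous_iff_isClosed]
  intro C hC
  have : f ⁻¹' C = Prod.fst '' ({p : X × Y | p.2 = f p.1} ∩ Prod.snd ⁻¹' C) := by
    ext x
    constructor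
    · exact fun hx => ⟨(x, f x), ⟨rfl, hx⟩, rfl⟩
    · rintro ⟨⟨x', y⟩, ⟨h1, h2⟩, rfl⟩
      simp only [mem_ofPred_eq] at h1
      simpa [← h1] using h2
  rw [this]
  exact isClosedMap_fst_of_compactSpace _ (hf.inter (hC.preimage continuous_snd))

/-- The central projection towards the minimizer deforms a path in `D \ U_g` between points of
the level set of `g` into a path in this level set. -/
theorem IsStrictlyConvexIn.precedes_of_joinedIn {n : ℕ} {D : Set (EuclideanSpace ℝ (Fin n))}
    {G : EuclideanSpace ℝ (Fin n) → ℝ} (hG : IsStrictlyConvexIn D G) (hcomp : IsCompact D)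
    (hcont : ContinuousOn G D) {m : EuclideanSpace ℝ (Fin n)} (hm : m ∈ D)
    (hmin : IsMinOn G D m) {x y : D} (hxy : G x = G y)
    (h : JoinedIn (D \ sublevel D G (G y)) (x : EuclideanSpace ℝ (Fin n)) y) :
    Precedes D G x y := by
  have hDc : CompactSpace D := isCompact_iff_compactSpace.1 hcomp
  have hex : ∀ w : ↥(D \ sublevel D G (G y)), ∃ z : D,
      (z : EuclideanSpace ℝ (Fin n)) ∈ segment ℝ m w ∧ G z = G y := by
    intro w
    obtain ⟨hwD, hw⟩ := mem_sdiff_sublevel.1 w.2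
    obtain ⟨z, hz, hzg⟩ := exists_mem_segment_eq hG.1.1 hcont hm hwD (hmin y.2) hw
    exact ⟨⟨z, hG.1.1.segment_subset hm hwD hz⟩, hz, hzg⟩
  choose θ hθ hθg using hex
  have huniq : ∀ (w : ↥(D \ sublevel D G (G y))) (z : D),
      (z : EuclideanSpace ℝ (Fin n)) ∈ segment ℝ m w → G z = G y → z = θ w := fun w z hz hzg =>
    Subtype.ext (hG.eq_of_mem_segment hm hmin (mem_sdiff_sublevel.1 w.2).1 hz (hθ w)
      (hzg.trans (hθg w).symm))
  have hGc : Continuous fun z : D => G z := hcont.domRestrict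
  -- Lying on a segment is the equality case of the triangle inequality, hence a closed condition
  -- even when the endpoints vary.
  have hdist : ∀ a b c : EuclideanSpace ℝ (Fin n),
      dist a b + dist b c = dist a c ↔ b ∈ segment ℝ a c := fun a b c => by
    rw [dist_add_dist_eq_iff, mem_segment_iff_wbtw]
  have hθc : Continuous θ := by
    refine continuous_of_isClosed_graph ?_
    have : {p : ↥(D \ sublevel D G (G y)) × D | p.2 = θ p.1} =
        {p | dist m (p.2 : EuclideanSpace ℝ (Fin n)) + dist (p.2 : EuclideanSpace ℝ (Fin n)) p.1 =
          dist m (p.1 : EuclideanSpace ℝ (Fin n))} ∩ {p | G p.2 = G y} := by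
      ext p
      simp only [mem_ofPred_eq, mem_inter_iff, hdist]
      exact ⟨fun h => by rw [h]; exact ⟨hθ _, hθg _⟩, fun h => huniq _ _ h.1 h.2⟩
    rw [this]
    exact (isClosed_eq (by fun_prop) (by fun_prop)).inter
      (isClosed_eq (hGc.comp continuous_snd) continuous_const)
  obtain ⟨γ, hγ⟩ := h
  have e0 : θ ⟨γ 0, hγ 0⟩ = x := by
    refine (huniq _ x ?_ hxy).symm
    simp [right_mem_segment]
  have e1 : θ ⟨γ 1, hγ 1⟩ = y := by
    refine (huniq _ y ?_ rfl).symm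
    simp [right_mem_segment]
  refine ⟨⟨⟨fun t => θ ⟨γ t, hγ t⟩, hθc.comp (γ.continuous.subtype_mk _)⟩, e0, e1⟩,
    fun s t _ => ?_⟩
  exact ((hθg _).trans (hθg _).symm).le

/-- For the converse, descend from `x` towards the minimizer to the level of `y`; the remaining path
to `y` is pushed into this level set by the central projection. -/
theorem IsStrictlyConvexIn.precedes_iff {n : ℕ} {D : Set (EuclideanSpace ℝ (Fin n))}
    {G : EuclideanSpace ℝ (Fin n) → ℝ} (hG : IsStrictlyConvexIn D G) (hcomp : IsCompact D)
    (hcont : ContinuousOn G D) {x y : D} :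
    Precedes D G x y ↔ G y ≤ G x ∧
      JoinedIn (D \ sublevel D G (G y)) (x : EuclideanSpace ℝ (Fin n)) y := by
  refine ⟨fun h => ⟨h.le, h.joinedIn⟩, fun ⟨hle, hj⟩ => ?_⟩
  obtain ⟨m, hm, hmin⟩ := hcomp.exists_isMinOn ⟨x, x.2⟩ hcont
  obtain ⟨z, hz, hzg⟩ := exists_mem_segment_eq hG.1.1 hcont hm x.2 (hmin y.2) hle
  have hxz : Precedes D G x ⟨z, hG.1.1.segment_subset hm x.2 hz⟩ :=
    hG.1.precedes_of_mem_segment hm hmin hz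
  have hj' := hxz.joinedIn
  simp only [hzg] at hj'
  exact hxz.trans (hG.precedes_of_joinedIn hcomp hcont hm hmin hzg (hj'.symm.trans hj))

/-! ### Path components of superlevel sets and their vertices. -/

/-- A point can be moved to some vertex along a segment on which `G` stays at least as large as
at the point. -/
theorem IsBoundedPolyhedron.exists_extremePoint_joinedIn {n : ℕ}
    {D : Set (EuclideanSpace ℝ (Fin n))} (hD : IsBoundedPolyhedron D)
    {G : EuclideanSpace ℝ (Fin n) → ℝ} (hG : ConvexOn ℝ D G) {x : EuclideanSpace ℝ (Fin n)}
    (hx : x ∈ D) : ∃ v ∈ D.extremePoints ℝ, JoinedIn (D \ sublevel D G (G x)) x v := by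
  have hU : Convex ℝ {y ∈ D | G y < G x} := hG.convex_lt (G x)
  -- `N` consists of the points seen from `x` through the strict sublevel set. It is convex and
  -- omits `x`, so it cannot contain all vertices.
  set N : Set (EuclideanSpace ℝ (Fin n)) :=
    {z | ∃ t : ℝ, 0 < t ∧ t ≤ 1 ∧ x + t • (z - x) ∈ {y ∈ D | G y < G x}} with hN
  have hNc : Convex ℝ N := by
    rintro p ⟨s, hs, hs1, hp⟩ q ⟨t, ht, ht1, hq⟩ a b ha hb hab
    have hge : 1 ≤ a / s + b / t := by
      have h1 : a ≤ a / s := by rw [le_div_iff₀ hs]; nlinarith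
      have h2 : b ≤ b / t := by rw [le_div_iff₀ ht]; nlinarith
      linarith
    have hpos : 0 < a / s + b / t := one_pos.trans_le hge
    -- With this parameter, the point on the way from `x` to `a • p + b • q` is a convex combination
    -- of the given sublevel points on the ways to `p` and `q`.
    refine ⟨(a / s + b / t)⁻¹, inv_pos.mpr hpos, inv_le_one_of_one_le₀ hge, ?_⟩
    have := hU hp hq (a := (a / s + b / t)⁻¹ * (a / s)) (b := (a / s + b / t)⁻¹ * (b / t))
      (by positivity) (by positivity) (by rw [← mul_add, inv_mul_cancel₀ hpos.ne'])
    convert this using 1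
    set c := (a / s + b / t)⁻¹ with hc
    have h1 : c * (a / s) + c * (b / t) = 1 := by
      rw [← mul_add, hc, inv_mul_cancel₀ hpos.ne']
    have h2 : c * (a / s) * s = c * a := by field_simp
    have h3 : c * (b / t) * t = c * b := by field_simp
    calc x + c • (a • p + b • q - x)
        = x + ((c * a) • (p - x) + (c * b) • (q - x)) := by
          have : x = (a + b) • x := by rw [hab, one_smul]
          nth_rewrite 2 [this]
          module
      _ = (c * (a / s) + c * (b / t)) • x + ((c * (a / s) * s) • (p - x) +
            (c * (b / t) * t) • (q - x)) := by rw [h1, h2, h3, one_smul]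
      _ = _ := by module
  obtain ⟨v, hv, hvN⟩ : ∃ v ∈ D.extremePoints ℝ, v ∉ N := by
    by_contra! h
    obtain ⟨t, -, -, -, ht⟩ := hD.subset_of_extremePoints_subset hNc h hx
    simp at ht
  refine ⟨v, hv, JoinedIn.of_segment_subset fun w hw => ?_⟩
  have hwD := hD.convex.segment_subset hx hv.1 hw
  refine mem_sdiff_sublevel.2 ⟨hwD, ?_⟩
  by_contra hlt
  rw [segment_eq_image'] at hw
  obtain ⟨t, ht, rfl⟩ := hw
  rcases ht.1.eq_or_lt with rfl | h0
  · simp at hlt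
  · exact hvN ⟨t, h0, ht.2, hwD, not_le.mp hlt⟩

/-- `IsUpperComponent` determines the component: it is the one containing the point. -/
theorem IsStrictlyConvexIn.isUpperComponent_iff {n : ℕ} {D : Set (EuclideanSpace ℝ (Fin n))}
    {G : EuclideanSpace ℝ (Fin n) → ℝ} (hG : IsStrictlyConvexIn D G) (hcomp : IsCompact D)
    (hcont : ContinuousOn G D) {x : D} {W : Set (EuclideanSpace ℝ (Fin n))} :
    IsUpperComponent D G x W ↔ W = pathComponentIn (D \ sublevel D G (G x)) x := by
  have hxF : (x : EuclideanSpace ℝ (Fin n)) ∈ D \ sublevel D G (G x) :=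
    mem_sdiff_sublevel.2 ⟨x.2, le_rfl⟩
  -- The projection moves each point within its own component. So `x ∈ θ(W)` already forces `W` to
  -- be the component of `x`.
  have hproj : ∀ y ∈ D \ sublevel D G (G x), ∀ z ∈ projImage D G (G x)
      (pathComponentIn (D \ sublevel D G (G x)) y),
      z ∈ pathComponentIn (D \ sublevel D G (G x)) y ∧ G z = G x := by
    rintro y - z ⟨m, hm, hmin, w, hw, hz, hzg⟩
    have hwD := (pathComponentIn_subset hw).1
    have hj := (hG.1.precedes_of_mem_segment hm hmin (y := ⟨w, hwD⟩)
      (z := ⟨z, hG.1.1.segment_subset hm hwD hz⟩) hz).joinedIn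
    simp only [hzg] at hj
    exact ⟨JoinedIn.trans hw hj, hzg⟩
  constructor
  · rintro ⟨⟨y, hy, rfl⟩, h⟩
    have hx : (x : EuclideanSpace ℝ (Fin n)) ∈ projImage D G (G x)
        (pathComponentIn (D \ sublevel D G (G x)) y) := by
      rw [h]
      exact ⟨x, (precedesSetoid D G).refl x, rfl⟩
    exact (pathComponentIn_congr (hproj y hy _ hx).1).symm
  · rintro rfl
    refine ⟨⟨x, hxF, rfl⟩, Subset.antisymm (fun z hz => ?_) ?_⟩
    · obtain ⟨hzx, hzg⟩ := hproj x hxF z hz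
      have hzD := (pathComponentIn_subset hzx).1
      refine ⟨⟨z, hzD⟩, ⟨(hG.precedes_iff hcomp hcont).2 ⟨hzg.le, ?_⟩,
        (hG.precedes_iff hcomp hcont).2 ⟨hzg.ge, JoinedIn.symm hzx⟩⟩, rfl⟩
      simp only [hzg]
      exact hzx
    · rintro _ ⟨z, ⟨hxz, hzx⟩, rfl⟩
      obtain ⟨m, hm, hmin⟩ := hcomp.exists_isMinOn ⟨x, x.2⟩ hcont
      exact ⟨m, hm, hmin, z, hzx.joinedIn.symm, right_mem_segment ℝ _ _,
        hxz.le.antisymm hzx.le⟩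

/-- Vertices in one component of the graph of the 1-skeleton without `U_g` can be joined in
`D \ U_g`. -/
theorem joinedIn_of_reachable_cutGraph {n : ℕ} {D : Set (EuclideanSpace ℝ (Fin n))}
    (hD : IsCompact D) {G : EuclideanSpace ℝ (Fin n) → ℝ} (hcont : ContinuousOn G D) {g : ℝ}
    {v w : {v : D.extremePoints ℝ // g ≤ G v}} (h : (cutGraph D G g).Reachable v w) :
    JoinedIn (D \ sublevel D G g) (v.1 : EuclideanSpace ℝ (Fin n)) w.1 := by
  obtain ⟨p⟩ := h
  induction p with
  | @nil u => exact JoinedIn.refl (mem_sdiff_sublevel.2 ⟨u.1.2.1, u.2⟩)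
  | cons hadj _ ih =>
    refine JoinedIn.trans (JoinedIn.of_segment_subset fun z hz => ?_) ih
    have hzD := hadj.1.2.subset hz
    refine mem_sdiff_sublevel.2 ⟨hzD, hadj.2.trans (csInf_le ?_ ⟨z, hz, rfl⟩)⟩
    exact (hD.image_of_continuousOn hcont).bddBelow.mono (image_mono hadj.1.2.subset)

/-- Vertices which can be joined in `{G > g'}`, for a suitable `g' < g`, lie in one component of
the graph of the 1-skeleton without `U_g`. -/
theorem IsBoundedPolyhedron.exists_lt_forall_reachable {n : ℕ}
    {D : Set (EuclideanSpace ℝ (Fin n))} (hD : IsBoundedPolyhedron D)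
    {G : EuclideanSpace ℝ (Fin n) → ℝ} (hcont : ContinuousOn G D) (hconv : ConvexOn ℝ D G)
    (g : ℝ) : ∃ g' < g, ∀ v w : D.extremePoints ℝ,
      JoinedIn {z ∈ D | g' < G z} (v : EuclideanSpace ℝ (Fin n)) w →
      ∃ (hv : g ≤ G v) (hw : g ≤ G w), (cutGraph D G g).Reachable ⟨v, hv⟩ ⟨w, hw⟩ := by
  obtain ⟨g', hlt, hv, he⟩ := hD.exists_label_gap G g
  refine ⟨g', hlt, fun v w hj => ?_⟩
  refine ⟨hv v v.2 hj.source_mem.2.le, hv w w.2 hj.target_mem.2.le, ?_⟩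
  exact hD.reachable_of_joinedIn hcont hconv hv he hj

/-- The second component of `ω(x)`: the set of vertices in the component `W(x)`. -/
def upperVertices {n : ℕ} (D : Set (EuclideanSpace ℝ (Fin n)))
    (G : EuclideanSpace ℝ (Fin n) → ℝ) (x : D) : Set (EuclideanSpace ℝ (Fin n)) :=
  pathComponentIn (D \ sublevel D G (G x)) x ∩ D.extremePoints ℝ

theorem IsBoundedPolyhedron.upperVertices_nonempty {n : ℕ}
    {D : Set (EuclideanSpace ℝ (Fin n))} (hD : IsBoundedPolyhedron D)
    {G : EuclideanSpace ℝ (Fin n) → ℝ} (hG : ConvexOn ℝ D G) (x : D) :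
    (upperVertices D G x).Nonempty := by
  obtain ⟨v, hv, hj⟩ := hD.exists_extremePoint_joinedIn hG x.2
  exact ⟨v, hj, hv⟩

theorem sdiff_sublevel_subset_of_lt {n : ℕ} (D : Set (EuclideanSpace ℝ (Fin n)))
    (G : EuclideanSpace ℝ (Fin n) → ℝ) {g g' : ℝ} (h : g' < g) :
    D \ sublevel D G g ⊆ {z ∈ D | g' < G z} := fun _ hw =>
  ⟨hw.1, h.trans_le (mem_sdiff_sublevel.1 hw).2⟩

/-- The vertices joined to a given vertex `v` in `D \ U_g` form the vertex set of the component
of `v`. -/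
theorem IsBoundedPolyhedron.image_supp_eq {n : ℕ} {D : Set (EuclideanSpace ℝ (Fin n))}
    (hD : IsBoundedPolyhedron D) {G : EuclideanSpace ℝ (Fin n) → ℝ} (hcont : ContinuousOn G D)
    (hconv : ConvexOn ℝ D G) {g : ℝ} (v : {v : D.extremePoints ℝ // g ≤ G v}) :
    (fun v : {v : D.extremePoints ℝ // g ≤ G v} => (v.1 : EuclideanSpace ℝ (Fin n))) ''
        ((cutGraph D G g).connectedComponentMk v).supp =
      pathComponentIn (D \ sublevel D G g) v.1 ∩ D.extremePoints ℝ := by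
  ext w
  constructor
  · rintro ⟨w, hw, rfl⟩
    rw [SimpleGraph.ConnectedComponent.mem_supp_iff, SimpleGraph.ConnectedComponent.eq] at hw
    exact ⟨(joinedIn_of_reachable_cutGraph hD.isCompact hcont hw).symm, w.1.2⟩
  · rintro ⟨hj, hw⟩
    obtain ⟨g', hlt, h⟩ := hD.exists_lt_forall_reachable hcont hconv g
    obtain ⟨_, hwg, hr⟩ := h v.1 ⟨w, hw⟩
      (JoinedIn.mono hj (sdiff_sublevel_subset_of_lt D G hlt))
    refine ⟨⟨⟨w, hw⟩, hwg⟩, ?_, rfl⟩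
    rw [SimpleGraph.ConnectedComponent.mem_supp_iff, SimpleGraph.ConnectedComponent.eq]
    exact hr.symm

theorem IsBoundedPolyhedron.isComponentVertexSet_upperVertices {n : ℕ}
    {D : Set (EuclideanSpace ℝ (Fin n))} (hD : IsBoundedPolyhedron D)
    {G : EuclideanSpace ℝ (Fin n) → ℝ} (hcont : ContinuousOn G D) (hconv : ConvexOn ℝ D G)
    (x : D) : IsComponentVertexSet D G (G x) (upperVertices D G x) := by
  obtain ⟨v, hj, hv⟩ := hD.upperVertices_nonempty hconv x
  refine ⟨(cutGraph D G (G x)).connectedComponentMk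
    ⟨⟨v, hv⟩, (mem_sdiff_sublevel.1 (JoinedIn.target_mem hj)).2⟩, ?_⟩
  rw [hD.image_supp_eq hcont hconv, upperVertices, pathComponentIn_congr hj]

/-- The component of `x` contains a vertex; by the inclusion this vertex is also joined to `y`,
which links `x` and `y` in `D \ U_{G y}`. -/
theorem IsBoundedPolyhedron.precedes_iff_upperVertices_subset {n : ℕ}
    {D : Set (EuclideanSpace ℝ (Fin n))} (hD : IsBoundedPolyhedron D)
    {G : EuclideanSpace ℝ (Fin n) → ℝ} (hcont : ContinuousOn G D)
    (hG : IsStrictlyConvexIn D G) {x y : D} :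
    Precedes D G x y ↔ G y ≤ G x ∧ upperVertices D G x ⊆ upperVertices D G y := by
  rw [hG.precedes_iff hD.isCompact hcont]
  refine and_congr_right fun hle => ⟨fun hj v hv => ⟨?_, hv.2⟩, fun hsub => ?_⟩
  · exact hj.symm.trans (JoinedIn.mono hv.1 (sdiff_sublevel_subset D G hle))
  · obtain ⟨v, hv⟩ := hD.upperVertices_nonempty hG.1 x
    exact (JoinedIn.mono hv.1 (sdiff_sublevel_subset D G hle)).trans (JoinedIn.symm (hsub hv).1)

/-! ### The coordinate map. -/

/-- The map `ω : D → 𝒴`. -/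
def treeCoord {n : ℕ} {D : Set (EuclideanSpace ℝ (Fin n))} (hD : IsBoundedPolyhedron D)
    {G : EuclideanSpace ℝ (Fin n) → ℝ} (hcont : ContinuousOn G D) (hconv : ConvexOn ℝ D G)
    (x : D) : CoordSpace D G :=
  ⟨(G x, upperVertices D G x),
    ⟨csInf_le (hD.isCompact.image_of_continuousOn hcont).bddBelow ⟨x, x.2, rfl⟩,
      le_csSup (hD.isCompact.image_of_continuousOn hcont).bddAbove ⟨x, x.2, rfl⟩⟩,
    hD.isComponentVertexSet_upperVertices hcont hconv x⟩

theorem treeCoord_le_treeCoord {n : ℕ} {D : Set (EuclideanSpace ℝ (Fin n))}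
    (hD : IsBoundedPolyhedron D) {G : EuclideanSpace ℝ (Fin n) → ℝ} (hcont : ContinuousOn G D)
    (hG : IsStrictlyConvexIn D G) {x y : D} :
    treeCoord hD hcont hG.1 y ≤ treeCoord hD hcont hG.1 x ↔ Precedes D G x y :=
  (hD.precedes_iff_upperVertices_subset hcont hG).symm

/-- A preimage of `(g, M)` arises by sliding any vertex of `M` towards the minimizer down to level
`g`, which stays inside its component. -/
theorem treeCoord_surjective {n : ℕ} {D : Set (EuclideanSpace ℝ (Fin n))}
    (hD : IsBoundedPolyhedron D) {G : EuclideanSpace ℝ (Fin n) → ℝ} (hcont : ContinuousOn G D)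
    (hconv : ConvexOn ℝ D G) : Function.Surjective (treeCoord hD hcont hconv) := by
  rintro ⟨⟨g, M⟩, hg, C, hC⟩
  induction C using SimpleGraph.ConnectedComponent.ind with | h v => ?_
  simp only at hg hC
  have hvD := v.1.2.1
  obtain ⟨m, hm, hmin⟩ := hD.isCompact.exists_isMinOn ⟨_, hvD⟩ hcont
  have hmg : G m ≤ g :=
    (le_csInf (Set.Nonempty.image G ⟨m, hm⟩) (by rintro _ ⟨z, hz, rfl⟩; exact hmin hz)).trans
      hg.1
  obtain ⟨z, hz, hzg⟩ := exists_mem_segment_eq hD.convex hcont hm hvD hmg v.2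
  have hzD := hD.convex.segment_subset hm hvD hz
  have hj := (hconv.precedes_of_mem_segment hm hmin (y := ⟨v.1, hvD⟩) (z := ⟨z, hzD⟩) hz).joinedIn
  simp only [hzg] at hj
  refine ⟨⟨z, hzD⟩, Subtype.ext (Prod.ext hzg ?_)⟩
  change upperVertices D G ⟨z, hzD⟩ = M
  rw [hC, hD.image_supp_eq hcont hconv, upperVertices]
  simp only [hzg]
  rw [pathComponentIn_congr hj]

/-- A point `y` near `x` satisfies `G y > g'`, where no label lies in `[g', G x)`. A vertex above
`y` is thus joined in `{G > g'}` to a vertex above `x`, so it lies in the same graph component. The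
reverse inclusion can fail where branches meet, which is why the neighbourhoods `V_ρ` are one-sided.
-/
theorem continuous_treeCoord {n : ℕ} {D : Set (EuclideanSpace ℝ (Fin n))}
    (hD : IsBoundedPolyhedron D) {G : EuclideanSpace ℝ (Fin n) → ℝ} (hcont : ContinuousOn G D)
    (hconv : ConvexOn ℝ D G) : Continuous (treeCoord hD hcont hconv) := by
  rw [continuous_iff_continuousAt]
  intro x
  rw [ContinuousAt, (CoordSpace.nhds_hasBasis _).tendsto_right_iff]
  intro ρ hρ
  have hGc : Continuous fun z : D => G z := hcont.domRestrict
  obtain ⟨g', hlt, hg'⟩ := hD.exists_lt_forall_reachable hcont hconv (G x)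
  obtain ⟨v, hv⟩ := hD.upperVertices_nonempty hconv x
  have hev : ∀ᶠ y : D in 𝓝 x, g' < G y := hGc.continuousAt.eventually (lt_mem_nhds hlt)
  have hdist : ∀ᶠ y : D in 𝓝 x, |G x - G y| < ρ := by
    filter_upwards [hGc.continuousAt.eventually (Metric.ball_mem_nhds (G x) hρ)] with y hy
    rwa [abs_sub_comm]
  obtain ⟨r, hr, hball⟩ := Metric.eventually_nhds_iff_ball.1 hev
  filter_upwards [hev, hdist, Metric.ball_mem_nhds x hr] with y hy hyρ hyr
  refine ⟨hyρ, fun w hw => ⟨?_, hw.2⟩⟩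
  have hxy : JoinedIn {z ∈ D | g' < G z} (x : EuclideanSpace ℝ (Fin n)) y := by
    refine JoinedIn.of_segment_subset fun z hz => ?_
    have hzD := hD.convex.segment_subset x.2 y.2 hz
    refine ⟨hzD, hball ⟨z, hzD⟩ ?_⟩
    exact (convex_ball (x : EuclideanSpace ℝ (Fin n)) r).segment_subset
      (Metric.mem_ball_self hr) hyr hz
  have hvx : JoinedIn {z ∈ D | g' < G z} v (x : EuclideanSpace ℝ (Fin n)) :=
    (JoinedIn.mono hv.1 (sdiff_sublevel_subset_of_lt D G hlt)).symm
  have hyw : JoinedIn {z ∈ D | g' < G z} (y : EuclideanSpace ℝ (Fin n)) w :=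
    JoinedIn.mono hw.1 (sdiff_sublevel_subset_of_lt D G hy)
  obtain ⟨_, _, hvw⟩ := hg' ⟨v, hv.2⟩ ⟨w, hw.2⟩ ((hvx.trans hxy).trans hyw)
  exact JoinedIn.trans hv.1 (joinedIn_of_reachable_cutGraph hD.isCompact hcont hvw)

/-! ### Hausdorffness, compactness and the homeomorphism. -/

theorem IsComponentVertexSet.nonempty {n : ℕ} {D : Set (EuclideanSpace ℝ (Fin n))}
    {G : EuclideanSpace ℝ (Fin n) → ℝ} {g : ℝ} {M : Set (EuclideanSpace ℝ (Fin n))}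
    (h : IsComponentVertexSet D G g M) : M.Nonempty := by
  obtain ⟨C, rfl⟩ := h
  exact C.nonempty_supp.image _

theorem IsComponentVertexSet.eq_of_mem {n : ℕ} {D : Set (EuclideanSpace ℝ (Fin n))}
    {G : EuclideanSpace ℝ (Fin n) → ℝ} {g : ℝ} {M M' : Set (EuclideanSpace ℝ (Fin n))}
    (h : IsComponentVertexSet D G g M) (h' : IsComponentVertexSet D G g M')
    {v : EuclideanSpace ℝ (Fin n)} (hv : v ∈ M) (hv' : v ∈ M') : M = M' := by
  obtain ⟨C, rfl⟩ := h
  obtain ⟨C', rfl⟩ := h'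
  obtain ⟨u, hu, rfl⟩ := hv
  obtain ⟨u', hu', huu⟩ := hv'
  obtain rfl : u' = u := Subtype.ext (Subtype.ext huu)
  rw [SimpleGraph.ConnectedComponent.mem_supp_iff] at hu hu'
  rw [← hu, ← hu']

/-- On one level, distinct vertex sets are disjoint, so they have no common nonempty subset and any
radii work; on different levels, half the distance of the levels suffices. -/
instance CoordSpace.t2Space {n : ℕ} (D : Set (EuclideanSpace ℝ (Fin n)))
    (G : EuclideanSpace ℝ (Fin n) → ℝ) : T2Space (CoordSpace D G) := by
  refine t2Space_iff_disjoint_nhds.2 fun p q hpq => ?_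
  change Disjoint (𝓝 p) (𝓝 q)
  rw [(CoordSpace.nhds_hasBasis p).disjoint_iff (CoordSpace.nhds_hasBasis q)]
  by_cases h : p.1.1 = q.1.1
  · refine ⟨1, one_pos, 1, one_pos, Set.disjoint_left.2 fun r hr hr' => hpq ?_⟩
    obtain ⟨v, hv⟩ := IsComponentVertexSet.nonempty r.2.2
    exact Subtype.ext (Prod.ext h (IsComponentVertexSet.eq_of_mem p.2.2 (h ▸ q.2.2)
      (hr.2 hv) (hr'.2 hv)))
  · have hpos : 0 < |p.1.1 - q.1.1| := abs_pos.2 (sub_ne_zero.2 h)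
    refine ⟨_, half_pos hpos, _, half_pos hpos, Set.disjoint_left.2 fun r hr hr' => ?_⟩
    have h1 := abs_sub_le p.1.1 r.1.1 q.1.1
    have h2 := hr.1
    have h3 := hr'.1
    rw [abs_sub_comm] at h3
    linarith

theorem ThermoTree.compactSpace {n : ℕ} {D : Set (EuclideanSpace ℝ (Fin n))}
    (hD : IsCompact D) (G : EuclideanSpace ℝ (Fin n) → ℝ) : CompactSpace (ThermoTree D G) := by
  have := isCompact_iff_compactSpace.1 hD
  refine ⟨?_⟩
  have hsurj : range (treeProj D G) = univ :=
    range_eq_univ.2 fun a => Quotient.exists_rep a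
  rw [← hsurj]
  exact isCompact_range continuous_coinduced_rng

theorem theorem3p3 (n : ℕ) (D : Set (EuclideanSpace ℝ (Fin n)))
    (hD : IsBoundedPolyhedron D) (hne : D.Nonempty)
    (G : EuclideanSpace ℝ (Fin n) → ℝ) (hcont : ContinuousOn G D)
    (hconv : IsStrictlyConvexIn D G) :
    (∀ x : D, ∃! W : Set (EuclideanSpace ℝ (Fin n)), IsUpperComponent D G x W) ∧
    ∃ Φ : ThermoTree D G ≃ₜ CoordSpace D G,
      (∀ a b : ThermoTree D G, Φ a ≤ Φ b ↔ a ≤ b) ∧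
      ∀ (x : D) (W : Set (EuclideanSpace ℝ (Fin n))), IsUpperComponent D G x W →
        (Φ (treeProj D G x)).1 = (G x, W ∩ D.extremePoints ℝ) := by
  have hW : ∀ (x : D) (W : Set (EuclideanSpace ℝ (Fin n))), IsUpperComponent D G x W ↔
      W = pathComponentIn (D \ sublevel D G (G x)) x := fun x W =>
    hconv.isUpperComponent_iff hD.isCompact hcont
  refine ⟨fun x => ⟨_, (hW x _).2 rfl, fun W h => (hW x W).1 h⟩, ?_⟩
  have hle : ∀ {x y : D}, treeCoord hD hcont hconv.1 y ≤ treeCoord hD hcont hconv.1 x ↔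
      Precedes D G x y := treeCoord_le_treeCoord hD hcont hconv
  let f : ThermoTree D G → CoordSpace D G := Quotient.lift (treeCoord hD hcont hconv.1)
    fun x y h => le_antisymm (hle.2 h.2) (hle.2 h.1)
  have hf : ∀ a b, f a ≤ f b ↔ a ≤ b := fun a b =>
    Quotient.inductionOn₂ a b fun x y => hle
  have hbij : Function.Bijective f := by
    -- Injectivity is automatic, since `f` reflects the order.
    refine ⟨fun a b h => le_antisymm ((hf a b).1 h.le) ((hf b a).1 h.ge), fun p => ?_⟩
    obtain ⟨x, rfl⟩ := treeCoord_surjective hD hcont hconv.1 p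
    exact ⟨treeProj D G x, rfl⟩
  have hfc : Continuous f :=
    continuous_coinduced_dom.2 (continuous_treeCoord hD hcont hconv.1)
  have := ThermoTree.compactSpace hD.isCompact G
  refine ⟨Continuous.homeoOfEquivCompactToT2 (f := Equiv.ofBijective f hbij) hfc, hf, ?_⟩
  intro x W hxW
  rw [(hW x W).1 hxW]
  rfl
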